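/- Let $M$ be a smooth manifold of dimension $n\ge 1$. A Finsler metric on $M$ is a function $\tilde F$ on $TM$, smooth on $TM\setminus 0$, positive on nonzero vectors, with $\tilde F(x,cy)=c\,\tilde F(x,y)$ for $c>0$. It is strongly convex if $g_{ij}=\tfrac12(\tilde F^2)_{y^iy^j}$ is positive definite at every $(x,y)$ with $y\neq 0$. It is of Randers type if $\tilde F(x,y)=\sqrt{a_x(y,y)}+\beta_x(y)$ for a smooth Riemannian metric $a$ and a smooth $1$-form $\beta$ on $M$. It is Riemannian if $\tilde F(x,y)=\sqrt{g_x(y,y)}$ for a smooth Riemannian metric $g$. Navigation data consist of a smooth Riemannian metric $h$, a smooth vector field $W$ (the wind) and a smooth function $x\mapsto|u(x)|_h$ (the preassigned own speed of the ship), with $|W(x)|_h<|u(x)|_h\le 1$ for all $x\in M$. A trajectory is a piecewise $C^1$ path $\gamma:[0,T]\to M$, $T>0$, such that at all times $\dot\gamma=u+W(\gamma)$ for some $u\in T_{\gamma}M$ whose $h$-norm is the preassigned own speed at $\gamma$ (for one-sided derivatives at the break points and end points). It is time-optimal if no trajectory with the same initial and the same final point takes less time. The metric $\tilde F$ solves the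 generalized Zermelo navigation problem with data $(h,W,|u|_h)$ if * the $\tilde F$-length of every trajectory $\gamma:[0,T]\to M$ is its transit time $T$, and * the time-optimal trajectories are exactly the piecewise $C^1$ paths $\gamma:[0,T]\to M$ that have $\tilde F(\dot\gamma)=1$ and are of least $\tilde F$-length among all piecewise $C^1$ paths with nowhere vanishing (one-sided) velocity having the same initial and the same final point. Let $\tilde F$ be a strongly convex Finsler metric on $M$. Then: 1. $\tilde F$ is of Randers type if and only if it solves the generalized Zermelo navigation problem for some navigation data $(h,W,|u|_h)$ on $M$. Moreover, if $\tilde F$ is of Randers type, then for every smooth function $s:M\to(0,1]$ the data can be chosen with $|u(x)|_h=s(x)$ for all $x$. 2. Suppose that $\tilde F$ solves the generalized Zermelo navigation problem with data $(h,W,|u|_h)$. Then $\tilde F$ is Riemannian if and only if $W=0$; and $\tilde F$ is the norm of a Riemannian metric conformal to $h$, that is, $\tilde F(x,y)^2=\rho(x)\,h_x(y,y)$ for a smooth function $\rho>0$, if and only if $W=0$. Furthermore, $\tilde F(x,y)=c\,|y|_h$ for some constant $c>0$ if and only if $W=0$ and $h(u,u)=|u(x)|_h^2$ is constant on $M$.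 -/

import Mathlib

open Set Bundle
open scoped Manifold ContDiff

namespace ZermeloNavigation

/-- The model space `ℝⁿ` of an `n`-dimensional manifold. -/
abbrev Model (n : ℕ) : Type := EuclideanSpace ℝ (Fin n)

/-- The tangent space of an `n`-dimensional manifold at a point. -/
abbrev Tan (n : ℕ) {M : Type*} [TopologicalSpace M] [ChartedSpace (Model n) M] (x : M) : Type :=
  TangentSpace (𝓡 n) x

/-- Smooth Riemannian metrics on an `n`-dimensional manifold `M`. -/
abbrev RiemMetric (n : ℕ) (M : Type*) [TopologicalSpace M] [ChartedSpace (Model n) M]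
    [IsManifold (𝓡 n) ∞ M] :=
  ContMDiffRiemannianMetric (𝓡 n) ∞ (Model n) (fun x : M => TangentSpace (𝓡 n) x)

/-- A Finsler metric: a function on the tangent bundle that is smooth away from the zero section,
positive on nonzero vectors and positively homogeneous of degree one on every fibre. -/
structure FinslerMetric (n : ℕ) (M : Type*) [TopologicalSpace M] [ChartedSpace (Model n) M]
    [IsManifold (𝓡 n) ∞ M] where
  toFun (x : M) : Tan n x → ℝ
  contMDiffOn : ContMDiffOn (𝓡 n).tangent 𝓘(ℝ, ℝ) ∞
    (fun p : TangentBundle (𝓡 n) M => toFun p.1 p.2) {p | p.2 ≠ 0}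
  pos (x : M) (y : Tan n x) (hy : y ≠ 0) : 0 < toFun x y
  homogeneous (x : M) (c : ℝ) (hc : 0 < c) (y : Tan n x) : toFun x (c • y) = c * toFun x y

section

variable {n : ℕ} {M : Type*} [TopologicalSpace M] [ChartedSpace (Model n) M]

/-! ### Piecewise `C¹` paths -/

/-- `γ` restricted to `[a, b]`, `a < b`, is a piecewise `C¹` path all of whose velocities (at the
finitely many break points and at the end points: the one-sided velocities) satisfy `P`. -/
def IsPathWith (γ : ℝ → M) (a b : ℝ) (P : ∀ x : M, Tan n x → Prop) : Prop :=
  a < b ∧ ContinuousOn γ (Icc a b) ∧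
    ∃ S : Set ℝ, S.Finite ∧
      ∀ c d : ℝ, a ≤ c → c < d → d ≤ b → Disjoint (Ioo c d) S →
        ContMDiffOn 𝓘(ℝ, ℝ) (𝓡 n) 1 γ (Icc c d) ∧
          ∀ t ∈ Icc c d, P (γ t) (mfderivWithin 𝓘(ℝ, ℝ) (𝓡 n) γ (Icc c d) t (1 : ℝ))

/-- A regular piecewise `C¹` path: all (one-sided) velocities are nonzero. -/
def IsRegularPath (γ : ℝ → M) (a b : ℝ) : Prop :=
  IsPathWith (n := n) γ a b (fun _ v => v ≠ 0)

variable [IsManifold (𝓡 n) ∞ M]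

/-- The norm `|y|_h = √h(y, y)`. -/
noncomputable def hnorm (h : RiemMetric n M) (x : M) (y : Tan n x) : ℝ :=
  √(h.inner x y y)

/-! ### Finsler metrics -/

namespace FinslerMetric

/-- The fundamental tensor `g_y(v, w) = ½ ∂²F(x, y + s v + t w)² / ∂s ∂t` at `s = t = 0`, that is,
the bilinear form with components `½ (F²)_{yⁱ yʲ}`. -/
noncomputable def fundamentalTensor (F : FinslerMetric n M) (x : M) (y v w : Tan n x) : ℝ :=
  deriv (fun s : ℝ => deriv (fun t : ℝ => (F.toFun x (y + s • v + t • w)) ^ 2 / 2) 0) 0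

/-- Strong convexity: the fundamental tensor is positive definite at every nonzero vector. -/
def IsStronglyConvex (F : FinslerMetric n M) : Prop :=
  ∀ (x : M) (y : Tan n x), y ≠ 0 → ∀ v : Tan n x, v ≠ 0 → 0 < F.fundamentalTensor x y v v

/-- `F = α + β` with `α` the norm of a Riemannian metric and `β` a smooth one-form. -/
def IsRanders (F : FinslerMetric n M) : Prop :=
  ∃ (a : RiemMetric n M) (β : ∀ x : M, Tan n x →L[ℝ] ℝ),
    ContMDiff (𝓡 n) ((𝓡 n).prod 𝓘(ℝ, Model n →L[ℝ] ℝ)) ∞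
      (fun x => TotalSpace.mk' (Model n →L[ℝ] ℝ)
        (E := fun x : M => TangentSpace (𝓡 n) x →L[ℝ] Bundle.Trivial M ℝ x) x (β x)) ∧
    ∀ (x : M) (y : Tan n x), F.toFun x y = hnorm a x y + β x y

/-- `F` is the norm of some Riemannian metric. -/
def IsRiemannian (F : FinslerMetric n M) : Prop :=
  ∃ g : RiemMetric n M, ∀ (x : M) (y : Tan n x), F.toFun x y = hnorm g x y

/-- `F` is the norm of a Riemannian metric conformal to `h`: `F² = ρ h` for a smooth positive
function `ρ`. -/
def IsConformalTo (F : FinslerMetric n M) (h : RiemMetric n M) : Prop :=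
  ∃ ρ : M → ℝ, ContMDiff (𝓡 n) 𝓘(ℝ, ℝ) ∞ ρ ∧ (∀ x, 0 < ρ x) ∧
    ∀ (x : M) (y : Tan n x), (F.toFun x y) ^ 2 = ρ x * h.inner x y y

/-- `F` is the norm of `h` up to a constant positive factor. -/
def IsScalingOf (F : FinslerMetric n M) (h : RiemMetric n M) : Prop :=
  ∃ c : ℝ, 0 < c ∧ ∀ (x : M) (y : Tan n x), F.toFun x y = c * hnorm h x y

/-- The `F`-length of `γ` on `[a, b]`. -/
noncomputable def length (F : FinslerMetric n M) (γ : ℝ → M) (a b : ℝ) : ℝ :=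
  ∫ t in a..b, F.toFun (γ t) (mfderiv 𝓘(ℝ, ℝ) (𝓡 n) γ t (1 : ℝ))

/-- `γ` on `[a, b]` is a regular path of least `F`-length among the regular paths with the same
initial and the same final point. -/
def IsShortest (F : FinslerMetric n M) (γ : ℝ → M) (a b : ℝ) : Prop :=
  IsRegularPath (n := n) γ a b ∧
    ∀ (σ : ℝ → M) (c d : ℝ), IsRegularPath (n := n) σ c d → σ c = γ a → σ d = γ b →
      F.length γ a b ≤ F.length σ c d

/-- `γ` on `[a, b]` is a path with `F`-speed one. -/
def IsUnitSpeed (F : FinslerMetric n M) (γ : ℝ → M) (a b : ℝ) : Prop :=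
  IsPathWith (n := n) γ a b (fun x v => F.toFun x v = 1)

end FinslerMetric

end

/-! ### The generalized Zermelo navigation problem -/

/-- The data of the navigation problem: a background Riemannian metric `h`, a wind `W` and the
preassigned own speed `speed x = |u(x)|_h` of the ship, subject to `|W|_h < |u|_h ≤ 1`. -/
structure NavigationData (n : ℕ) (M : Type*) [TopologicalSpace M] [ChartedSpace (Model n) M]
    [IsManifold (𝓡 n) ∞ M] where
  h : RiemMetric n M
  W (x : M) : Tan n x
  contMDiff_W : ContMDiff (𝓡 n) (𝓡 n).tangent ∞ (fun x => (⟨x, W x⟩ : TangentBundle (𝓡 n) M))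
  speed : M → ℝ
  contMDiff_speed : ContMDiff (𝓡 n) 𝓘(ℝ, ℝ) ∞ speed
  speed_le_one (x : M) : speed x ≤ 1
  wind_lt_speed (x : M) : hnorm h x (W x) < speed x

section

variable {n : ℕ} {M : Type*} [TopologicalSpace M] [ChartedSpace (Model n) M]
  [IsManifold (𝓡 n) ∞ M]

namespace NavigationData

/-- `γ`, parametrized by the time `t ∈ [0, T]`, is a trajectory of the ship: at every moment its
velocity is the sum `u + W` of an own velocity `u` with the preassigned speed and of the wind. -/
def IsTrajectory (D : NavigationData n M) (γ : ℝ → M) (T : ℝ) : Prop :=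
  IsPathWith (n := n) γ 0 T
    (fun x v => ∃ u : Tan n x, hnorm D.h x u = D.speed x ∧ v = u + D.W x)

/-- `γ` is a time-optimal trajectory: no trajectory with the same initial and the same final point
takes less time. -/
def IsTimeOptimal (D : NavigationData n M) (γ : ℝ → M) (T : ℝ) : Prop :=
  D.IsTrajectory γ T ∧
    ∀ (σ : ℝ → M) (T' : ℝ), D.IsTrajectory σ T' → σ 0 = γ 0 → σ T' = γ T → T ≤ T'

end NavigationData

/-- The Finsler metric `F` solves the navigation problem with data `D`: the `F`-length of every
trajectory is its transit time, and the time-optimal trajectories are exactly the shortest paths of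
`F`, run through with `F`-speed one. -/
structure FinslerMetric.Solves (F : FinslerMetric n M) (D : NavigationData n M) : Prop where
  transit_time (γ : ℝ → M) (T : ℝ) : D.IsTrajectory γ T → F.length γ 0 T = T
  timeOptimal_iff (γ : ℝ → M) (T : ℝ) :
    D.IsTimeOptimal γ T ↔ F.IsUnitSpeed γ 0 T ∧ F.IsShortest γ 0 T

end

end ZermeloNavigation

/-!
The velocities admitted at `x` by navigation data `(h, W, |u|)` form the `h`-sphere of radius
`|u(x)|` shifted by `W(x)`. Since `|W| < |u|`, this is the unit sphere of a unique positively
homogeneous function, and completing the square shows that it is a Randers norm `√a + β`. If `F` is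
this norm, then the trajectories are the paths of unit `F`-speed, and `F` solves the navigation
problem because every regular path can be parametrized by `F`-length. Conversely, every admitted
velocity is the initial velocity of a trajectory, and the transit times of the short initial pieces
of that trajectory force its initial `F`-speed to be `1`. Thus `F` solves the problem if and only if
it is the Randers norm of the data.

The correspondence between navigation data and Randers norms is inverted, for each own speed `|u|`,
by `h = |u|² ε (a - β ⊗ β)` and `W = -ε⁻¹ β♯` with `ε = 1 - |β|²`. A Riemannian norm is symmetric,
which forces `β = 0` and so `W = 0`; without wind, the Randers norm is `|u|⁻¹ |·|_h`.
-/

namespace ZermeloNavigation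

section VectorBundles

variable {𝕜 : Type*} [NontriviallyNormedField 𝕜] {k : WithTop ℕ∞}
  {EB : Type*} [NormedAddCommGroup EB] [NormedSpace 𝕜 EB]
  {HB : Type*} [TopologicalSpace HB] {IB : ModelWithCorners 𝕜 EB HB}
  {B : Type*} [TopologicalSpace B] [ChartedSpace HB B]
  {F₁ F₂ : Type*} [NormedAddCommGroup F₁] [NormedSpace 𝕜 F₁]
  [NormedAddCommGroup F₂] [NormedSpace 𝕜 F₂]

theorem continuous_trivial_section {X : Type*} [TopologicalSpace X] {b : X → B} {f : X → F₁}
    (h : Continuous fun x => TotalSpace.mk' F₁ (E := Bundle.Trivial B F₁) (b x) (f x)) :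
    Continuous f :=
  (continuous_snd.comp (Bundle.Trivial.homeomorphProd B F₁).continuous).comp h

theorem contMDiff_trivial_section_iff {s : B → F₁} :
    ContMDiff IB (IB.prod 𝓘(𝕜, F₁)) k
        (fun x => TotalSpace.mk' F₁ (E := Bundle.Trivial B F₁) x (s x)) ↔
      ContMDiff IB 𝓘(𝕜, F₁) k s := by
  simp only [ContMDiff, contMDiffAt_section]
  rfl

variable {E₁ E₂ : B → Type*}
  [TopologicalSpace (TotalSpace F₁ E₁)] [∀ x, TopologicalSpace (E₁ x)]
  [∀ x, AddCommGroup (E₁ x)] [∀ x, Module 𝕜 (E₁ x)] [FiberBundle F₁ E₁] [VectorBundle 𝕜 F₁ E₁]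
  [TopologicalSpace (TotalSpace F₂ E₂)] [∀ x, TopologicalSpace (E₂ x)]
  [∀ x, AddCommGroup (E₂ x)] [∀ x, Module 𝕜 (E₂ x)] [FiberBundle F₂ E₂] [VectorBundle 𝕜 F₂ E₂]

theorem inCoordinates_apply_trivializationAt {x₀ x : B} {φ : E₁ x →L[𝕜] E₂ x}
    (h₁ : x ∈ (trivializationAt F₁ E₁ x₀).baseSet) (h₂ : x ∈ (trivializationAt F₂ E₂ x₀).baseSet)
    (v : E₁ x) :
    ContinuousLinearMap.inCoordinates F₁ E₁ F₂ E₂ x₀ x x₀ x φ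
      (trivializationAt F₁ E₁ x₀ ⟨x, v⟩).2 =
      (trivializationAt F₂ E₂ x₀ ⟨x, φ v⟩).2 := by
  have hv : ((trivializationAt F₁ E₁ x₀).continuousLinearEquivAt 𝕜 x h₁).symm
      (trivializationAt F₁ E₁ x₀ ⟨x, v⟩).2 = v :=
    ((trivializationAt F₁ E₁ x₀).continuousLinearEquivAt 𝕜 x h₁).symm_apply_apply v
  simp [ContinuousLinearMap.inCoordinates_eq h₁ h₂, hv]

theorem isInvertible_inCoordinates {x₀ x : B} {φ : E₁ x →L[𝕜] E₂ x}
    (h₁ : x ∈ (trivializationAt F₁ E₁ x₀).baseSet) (h₂ : x ∈ (trivializationAt F₂ E₂ x₀).baseSet)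
    (hφ : φ.IsInvertible) :
    (ContinuousLinearMap.inCoordinates F₁ E₁ F₂ E₂ x₀ x x₀ x φ).IsInvertible := by
  simpa [ContinuousLinearMap.inCoordinates_eq h₁ h₂] using hφ

variable [∀ x, IsTopologicalAddGroup (E₂ x)] [∀ x, ContinuousSMul 𝕜 (E₂ x)]

theorem contMDiff_smulRight {β : ∀ x, E₁ x →L[𝕜] 𝕜} {s : ∀ x, E₂ x}
    (hβ : ContMDiff IB (IB.prod 𝓘(𝕜, F₁ →L[𝕜] 𝕜)) k (fun x => TotalSpace.mk' (F₁ →L[𝕜] 𝕜)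
      (E := fun x => E₁ x →L[𝕜] Bundle.Trivial B 𝕜 x) x (β x)))
    (hs : ContMDiff IB (IB.prod 𝓘(𝕜, F₂)) k (fun x => TotalSpace.mk' F₂ x (s x))) :
    ContMDiff IB (IB.prod 𝓘(𝕜, F₁ →L[𝕜] F₂)) k (fun x => TotalSpace.mk' (F₁ →L[𝕜] F₂)
      (E := fun x => E₁ x →L[𝕜] E₂ x) x ((β x).smulRight (s x))) := by
  intro x₀
  have hβ' := hβ x₀
  have hs' := hs x₀
  rw [contMDiffAt_hom_bundle] at hβ' ⊢
  rw [contMDiffAt_section] at hs'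
  refine ⟨contMDiffAt_id, ?_⟩
  have hsmulRight : ContDiff 𝕜 k fun p : (F₁ →L[𝕜] 𝕜) × F₂ => p.1.smulRight p.2 :=
    contDiff_fst.smulRight contDiff_snd
  refine ((hsmulRight.contMDiff.contMDiffAt).comp x₀
    (hβ'.2.prodMk_space hs')).congr_of_eventuallyEq ?_
  filter_upwards [(trivializationAt F₂ E₂ x₀).open_baseSet.mem_nhds
    (FiberBundle.mem_baseSet_trivializationAt' x₀)] with x hx₂
  ext v
  simp [ContinuousLinearMap.inCoordinates, Trivialization.linearMapAt_apply, hx₂]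

theorem contMDiff_of_clm_bundle_apply [CompleteSpace F₁] {φ : ∀ x, E₁ x →L[𝕜] E₂ x}
    (hinv : ∀ x, (φ x).IsInvertible) {s : ∀ x, E₁ x}
    (hφ : ContMDiff IB (IB.prod 𝓘(𝕜, F₁ →L[𝕜] F₂)) k (fun x => TotalSpace.mk' (F₁ →L[𝕜] F₂)
      (E := fun x => E₁ x →L[𝕜] E₂ x) x (φ x)))
    (hs : ContMDiff IB (IB.prod 𝓘(𝕜, F₂)) k (fun x => TotalSpace.mk' F₂ x (φ x (s x)))) :
    ContMDiff IB (IB.prod 𝓘(𝕜, F₁)) k (fun x => TotalSpace.mk' F₁ x (s x)) := by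
  intro x₀
  have hφ₀ := ((contMDiffAt_hom_bundle _).mp (hφ x₀)).2
  have hs₀ := (contMDiffAt_section _).mp (hs x₀)
  rw [contMDiffAt_section]
  have h₁ := FiberBundle.mem_baseSet_trivializationAt' (F := F₁) (E := E₁) x₀
  have h₂ := FiberBundle.mem_baseSet_trivializationAt' (F := F₂) (E := E₂) x₀
  have hinverse := (isInvertible_inCoordinates h₁ h₂ (hinv x₀)).contDiffAt_map_inverse (n := k)
  refine ((hinverse.contMDiffAt.comp x₀ hφ₀).clm_apply hs₀).congr_of_eventuallyEq ?_
  filter_upwards [(trivializationAt F₁ E₁ x₀).open_baseSet.mem_nhds h₁,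
    (trivializationAt F₂ E₂ x₀).open_baseSet.mem_nhds h₂] with x hx₁ hx₂
  rw [← inCoordinates_apply_trivializationAt hx₁ hx₂ (s x)]
  obtain ⟨A, hA⟩ := isInvertible_inCoordinates hx₁ hx₂ (hinv x)
  simp [← hA]

end VectorBundles

theorem isInvertible_of_injective_to_dual {𝕜 V : Type*} [NontriviallyNormedField 𝕜]
    [CompleteSpace 𝕜] [AddCommGroup V] [Module 𝕜 V] [TopologicalSpace V] [IsTopologicalAddGroup V]
    [ContinuousSMul 𝕜 V] [T2Space V] [FiniteDimensional 𝕜 V] {A : V →L[𝕜] V →L[𝕜] 𝕜}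
    (hA : Function.Injective A) : A.IsInvertible := by
  have hfinrank : Module.finrank 𝕜 V = Module.finrank 𝕜 (V →L[𝕜] 𝕜) := by
    rw [← (LinearMap.toContinuousLinearMap : (V →ₗ[𝕜] 𝕜) ≃ₗ[𝕜] V →L[𝕜] 𝕜).finrank_eq]
    exact (Subspace.dual_finrank_eq (K := 𝕜) (V := V)).symm
  exact ⟨(LinearEquiv.ofInjectiveOfFinrankEq (A : V →ₗ[𝕜] V →L[𝕜] 𝕜) hA
    hfinrank).toContinuousLinearEquiv, by ext; rfl⟩

section BilinearForms

variable {EB : Type*} [NormedAddCommGroup EB] [NormedSpace ℝ EB]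
  {HB : Type*} [TopologicalSpace HB] {IB : ModelWithCorners ℝ EB HB} {k : WithTop ℕ∞}
  {B : Type*} [TopologicalSpace B] [ChartedSpace HB B]
  {F : Type*} [NormedAddCommGroup F] [NormedSpace ℝ F]
  {E : B → Type*} [TopologicalSpace (TotalSpace F E)] [∀ x, TopologicalSpace (E x)]
  [∀ x, AddCommGroup (E x)] [∀ x, Module ℝ (E x)] [FiberBundle F E] [VectorBundle ℝ F E]

variable (IB k F) in
/-- A section `β` of the dual of the vector bundle `E` (a one-form, if `E` is the tangent bundle) is
of class `C^k`. -/
def IsContMDiffForm (β : ∀ x, E x →L[ℝ] ℝ) : Prop :=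
  ContMDiff IB (IB.prod 𝓘(ℝ, F →L[ℝ] ℝ)) k
    (fun x => TotalSpace.mk' (F →L[ℝ] ℝ) (E := fun x => E x →L[ℝ] Bundle.Trivial B ℝ x) x (β x))

theorem IsContMDiffForm.contMDiff_apply {β : ∀ x, E x →L[ℝ] ℝ} (hβ : IsContMDiffForm IB k F β)
    {s : ∀ x, E x} (hs : ContMDiff IB (IB.prod 𝓘(ℝ, F)) k (fun x => TotalSpace.mk' F x (s x))) :
    ContMDiff IB 𝓘(ℝ, ℝ) k (fun x => β x (s x)) :=
  contMDiff_trivial_section_iff.mp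
    (ContMDiff.clm_bundle_apply (E₂ := Bundle.Trivial B ℝ) (b := id) hβ hs)

theorem IsContMDiffForm.continuous {β : ∀ x, E x →L[ℝ] ℝ} (hβ : IsContMDiffForm IB k F β) :
    Continuous fun p : TotalSpace F E => β p.1 p.2 :=
  continuous_trivial_section (Continuous.clm_bundle_apply (E₁ := E) (F₁ := F)
    (E₂ := Bundle.Trivial B ℝ) (b := fun p : TotalSpace F E => p.1)
    (ContMDiff.continuous hβ |>.comp (FiberBundle.continuous_proj F E)) continuous_id)

theorem IsContMDiffForm.smul {β : ∀ x, E x →L[ℝ] ℝ} (hβ : IsContMDiffForm IB k F β) {p : B → ℝ}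
    (hp : ContMDiff IB 𝓘(ℝ, ℝ) k p) : IsContMDiffForm IB k F (fun x => p x • β x) :=
  ContMDiff.smul_section (V := fun x => E x →L[ℝ] Bundle.Trivial B ℝ x) hp hβ

theorem isContMDiffForm_inner (g : ContMDiffRiemannianMetric IB k F E) {s : ∀ x, E x}
    (hs : ContMDiff IB (IB.prod 𝓘(ℝ, F)) k (fun x => TotalSpace.mk' F x (s x))) :
    IsContMDiffForm IB k F (fun x => g.inner x (s x)) :=
  ContMDiff.clm_bundle_apply (E₁ := E) (b := id)
    (E₂ := fun x => E x →L[ℝ] Bundle.Trivial B ℝ x) g.contMDiff hs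

theorem continuous_inner_self (g : ContMDiffRiemannianMetric IB k F E) :
    Continuous fun p : TotalSpace F E => g.inner p.1 p.2 p.2 :=
  continuous_trivial_section (Continuous.clm_bundle_apply₂ (E₁ := E) (F₁ := F) (E₂ := E) (F₂ := F)
    (E₃ := Bundle.Trivial B ℝ) (b := fun p : TotalSpace F E => p.1)
    (g.contMDiff.continuous.comp (FiberBundle.continuous_proj F E)) continuous_id continuous_id)

theorem inner_self_nonneg (g : ContMDiffRiemannianMetric IB k F E) (x : B) (v : E x) :
    0 ≤ g.inner x v v :=
  (g.toRiemannianMetric.toCore x).re_inner_nonneg v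

theorem inner_sq_le (g : ContMDiffRiemannianMetric IB k F E) (x : B) (v w : E x) :
    g.inner x v w ^ 2 ≤ g.inner x v v * g.inner x w w := by
  let := g.toRiemannianMetric.toCore x
  have h := InnerProductSpace.Core.inner_mul_inner_self_le (𝕜 := ℝ) v w
  rw [InnerProductSpace.Core.norm_inner_symm w v, ← sq, Real.norm_eq_abs, sq_abs] at h
  exact h

variable [∀ x, ContinuousSMul ℝ (E x)]

theorem isVonNBounded_of_le_inner (g : ContMDiffRiemannianMetric IB k F E) {x : B} {c : ℝ}
    (hc : 0 < c) {q : E x → ℝ} (hq : ∀ v, c * g.inner x v v ≤ q v) :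
    Bornology.IsVonNBounded ℝ {v | q v < 1} := by
  have hsqrt : √c ≠ 0 := (Real.sqrt_pos.mpr hc).ne'
  refine ((g.isVonNBounded x).image ((√c)⁻¹ • ContinuousLinearMap.id ℝ (E x))).subset ?_
  intro v hv
  refine ⟨√c • v, ?_, by simp [smul_smul, hsqrt]⟩
  have : c * g.inner x v v < 1 := (hq v).trans_lt hv
  simpa [← mul_assoc, Real.mul_self_sqrt hc.le] using this

/-- The metric `p g + q β ⊗ β`; the bound `hle` by a multiple of `g` makes it definite and
compatible with the topology of the fibres. -/
noncomputable def perturbMetric (g : ContMDiffRiemannianMetric IB k F E) {β : ∀ x, E x →L[ℝ] ℝ}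
    (hβ : IsContMDiffForm IB k F β) {p q : B → ℝ} (hp : ContMDiff IB 𝓘(ℝ, ℝ) k p)
    (hq : ContMDiff IB 𝓘(ℝ, ℝ) k q) {c : B → ℝ} (hc : ∀ x, 0 < c x)
    (hle : ∀ x v, c x * g.inner x v v ≤ p x * g.inner x v v + q x * β x v ^ 2) :
    ContMDiffRiemannianMetric IB k F E where
  inner x := p x • g.inner x + q x • (β x).smulRight (β x)
  symm x v w := by simp [g.symm x v w, mul_comm (β x v)]
  pos x v hv := by
    have := (mul_pos (hc x) (g.pos x v hv)).trans_le (hle x v)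
    simpa [sq] using this
  isVonNBounded x := isVonNBounded_of_le_inner g (hc x) fun v => by simpa [sq] using hle x v
  contMDiff := ContMDiff.add_section
    (V := fun x => E x →L[ℝ] E x →L[ℝ] Bundle.Trivial B ℝ x)
    (ContMDiff.smul_section (V := fun x => E x →L[ℝ] E x →L[ℝ] Bundle.Trivial B ℝ x)
      hp g.contMDiff)
    (ContMDiff.smul_section (V := fun x => E x →L[ℝ] E x →L[ℝ] Bundle.Trivial B ℝ x)
      hq (contMDiff_smulRight hβ hβ))

theorem perturbMetric_inner (g : ContMDiffRiemannianMetric IB k F E) {β : ∀ x, E x →L[ℝ] ℝ}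
    (hβ : IsContMDiffForm IB k F β) {p q : B → ℝ} (hp : ContMDiff IB 𝓘(ℝ, ℝ) k p)
    (hq : ContMDiff IB 𝓘(ℝ, ℝ) k q) {c : B → ℝ} (hc : ∀ x, 0 < c x)
    (hle : ∀ x v, c x * g.inner x v v ≤ p x * g.inner x v v + q x * β x v ^ 2)
    (x : B) (v w : E x) : (perturbMetric g hβ hp hq hc hle).inner x v w =
      p x * g.inner x v w + q x * (β x v * β x w) := by
  simp [perturbMetric]

variable [∀ x, IsTopologicalAddGroup (E x)]

theorem isInvertible_inner [FiniteDimensional ℝ F] (g : ContMDiffRiemannianMetric IB k F E)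
    (x : B) : (g.inner x).IsInvertible := by
  let e := (trivializationAt F E x).continuousLinearEquivAt ℝ x
    (FiberBundle.mem_baseSet_trivializationAt' x)
  have : FiniteDimensional ℝ (E x) := e.symm.toLinearEquiv.finiteDimensional
  have : T2Space (E x) := e.toHomeomorph.symm.t2Space
  refine isInvertible_of_injective_to_dual ((injective_iff_map_eq_zero _).mpr fun v hv => ?_)
  by_contra hne
  exact (g.pos x v hne).ne' (by rw [hv]; rfl)

theorem exists_sharp [FiniteDimensional ℝ F] (g : ContMDiffRiemannianMetric IB k F E)
    {β : ∀ x, E x →L[ℝ] ℝ} (hβ : IsContMDiffForm IB k F β) :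
    ∃ s : ∀ x, E x, ContMDiff IB (IB.prod 𝓘(ℝ, F)) k (fun x => TotalSpace.mk' F x (s x)) ∧
      ∀ x, g.inner x (s x) = β x := by
  have : CompleteSpace F := FiniteDimensional.complete ℝ F
  choose A hA using isInvertible_inner g
  have hs (x : B) : g.inner x ((A x).symm (β x)) = β x := by
    rw [← hA, ContinuousLinearEquiv.coe_coe, ContinuousLinearEquiv.apply_symm_apply]
  refine ⟨fun x => (A x).symm (β x), ?_, hs⟩
  refine contMDiff_of_clm_bundle_apply (E₂ := fun x => E x →L[ℝ] Bundle.Trivial B ℝ x)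
    (isInvertible_inner g) g.contMDiff ?_
  simpa only [IsContMDiffForm, hs] using hβ

end BilinearForms

theorem sqrt_add_eq_iff_of_sq_le {A B c : ℝ} (hc : 0 < c) (h : B ^ 2 ≤ A) :
    √A + B = c ↔ A = (c - B) ^ 2 := by
  have hA : √A ^ 2 = A := Real.sq_sqrt ((sq_nonneg B).trans h)
  have hneg : √A ≠ -(c - B) := by linarith [Real.le_sqrt_of_sq_le h]
  rw [← hA, sq_eq_sq_iff_eq_or_eq_neg, or_iff_left hneg, hA, eq_sub_iff_add_eq]

section RandersNorm

variable {n : ℕ} {M : Type*} [TopologicalSpace M] [ChartedSpace (Model n) M]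
  [IsManifold (𝓡 n) ∞ M]

theorem hnorm_eq_iff (h : RiemMetric n M) {x : M} {v : Tan n x} {r : ℝ} (hr : 0 ≤ r) :
    hnorm h x v = r ↔ h.inner x v v = r ^ 2 :=
  Real.sqrt_eq_iff_eq_sq (inner_self_nonneg h x v) hr

theorem hnorm_smul (h : RiemMetric n M) (x : M) {c : ℝ} (hc : 0 ≤ c) (v : Tan n x) :
    hnorm h x (c • v) = c * hnorm h x v := by
  simp [hnorm, ← mul_assoc, Real.sqrt_mul (mul_self_nonneg c), Real.sqrt_mul_self hc]

theorem hnorm_neg (h : RiemMetric n M) (x : M) (v : Tan n x) : hnorm h x (-v) = hnorm h x v := by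
  simp [hnorm]

theorem hnorm_pos (h : RiemMetric n M) (x : M) {v : Tan n x} (hv : v ≠ 0) : 0 < hnorm h x v :=
  Real.sqrt_pos.mpr (h.pos x v hv)

namespace NavigationData

variable (D : NavigationData n M)

/-- `v` is the velocity at `x` of a ship that moves with its preassigned own speed through the
wind. -/
def IsVelocity (x : M) (v : Tan n x) : Prop :=
  ∃ u : Tan n x, hnorm D.h x u = D.speed x ∧ v = u + D.W x

/-- The function `λ = |u|² - |W|²`, the common denominator of the Randers norm of the data. -/
noncomputable def gap (x : M) : ℝ := D.speed x ^ 2 - D.h.inner x (D.W x) (D.W x)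

theorem speed_pos (x : M) : 0 < D.speed x :=
  (Real.sqrt_nonneg _).trans_lt (D.wind_lt_speed x)

theorem gap_pos (x : M) : 0 < D.gap x := by
  have h := D.wind_lt_speed x
  rw [hnorm, Real.sqrt_lt' (D.speed_pos x)] at h
  exact sub_pos.mpr h

theorem isContMDiffForm_inner_wind :
    IsContMDiffForm (𝓡 n) ∞ (Model n) (fun x => D.h.inner x (D.W x)) :=
  isContMDiffForm_inner D.h D.contMDiff_W

theorem contMDiff_gap : ContMDiff (𝓡 n) 𝓘(ℝ, ℝ) ∞ D.gap :=
  (D.contMDiff_speed.pow 2).sub (D.isContMDiffForm_inner_wind.contMDiff_apply D.contMDiff_W)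

theorem contMDiff_inv_gap : ContMDiff (𝓡 n) 𝓘(ℝ, ℝ) ∞ (fun x => (D.gap x)⁻¹) :=
  D.contMDiff_gap.inv₀ fun x => (D.gap_pos x).ne'

/-- The Riemannian metric `λ⁻¹ h + (λ⁻¹ h(W, ·))²` of the Randers norm of navigation data. -/
noncomputable def randersMetric : RiemMetric n M :=
  perturbMetric D.h D.isContMDiffForm_inner_wind D.contMDiff_inv_gap (D.contMDiff_inv_gap.pow 2)
    (c := fun x => (D.gap x)⁻¹) (fun x => inv_pos.mpr (D.gap_pos x))
    (fun _ _ => le_add_of_nonneg_right (by positivity))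

/-- The one-form `-λ⁻¹ h(W, ·)` of the Randers norm of navigation data. -/
noncomputable def randersForm (x : M) : Tan n x →L[ℝ] ℝ :=
  (-(D.gap x)⁻¹) • D.h.inner x (D.W x)

/-- The Randers norm of navigation data: the norm whose unit sphere at `x` is the sphere of
`h`-radius `|u(x)|` shifted by the wind, see `randersNorm_eq_one_iff`. -/
noncomputable def randersNorm (x : M) (v : Tan n x) : ℝ :=
  hnorm D.randersMetric x v + D.randersForm x v

theorem isContMDiffForm_randersForm : IsContMDiffForm (𝓡 n) ∞ (Model n) D.randersForm :=
  D.isContMDiffForm_inner_wind.smul D.contMDiff_inv_gap.neg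

theorem randersForm_apply (x : M) (v : Tan n x) :
    D.randersForm x v = -((D.gap x)⁻¹ * D.h.inner x (D.W x) v) := by
  simp [randersForm]

theorem randersMetric_inner_self (x : M) (v : Tan n x) : D.randersMetric.inner x v v =
    (D.gap x)⁻¹ * D.h.inner x v v + D.randersForm x v ^ 2 := by
  rw [randersMetric, perturbMetric_inner, randersForm_apply]
  ring

theorem randersForm_sq_le (x : M) (v : Tan n x) :
    D.randersForm x v ^ 2 ≤ D.randersMetric.inner x v v := by
  rw [randersMetric_inner_self]
  exact le_add_of_nonneg_left
    (mul_nonneg (inv_pos.mpr (D.gap_pos x)).le (inner_self_nonneg D.h x v))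

theorem isVelocity_iff (x : M) (v : Tan n x) :
    D.IsVelocity x v ↔ D.h.inner x v v - 2 * D.h.inner x (D.W x) v = D.gap x := by
  have hu : D.IsVelocity x v ↔ hnorm D.h x (v - D.W x) = D.speed x :=
    ⟨fun ⟨u, hu, huv⟩ => by simpa [huv] using hu, fun h => ⟨v - D.W x, h, by simp⟩⟩
  rw [hu, hnorm_eq_iff _ (D.speed_pos x).le, gap, eq_sub_iff_add_eq]
  simp only [map_sub, sub_apply, D.h.symm x v (D.W x)]
  ring_nf

theorem randersNorm_eq_one_iff (x : M) (v : Tan n x) :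
    D.randersNorm x v = 1 ↔ D.IsVelocity x v := by
  have hgap := (D.gap_pos x).ne'
  have hsphere : D.gap x * (D.randersMetric.inner x v v - (1 - D.randersForm x v) ^ 2) =
      D.h.inner x v v - 2 * D.h.inner x (D.W x) v - D.gap x := by
    rw [randersMetric_inner_self, randersForm_apply]
    field_simp
    ring
  rw [randersNorm, hnorm, sqrt_add_eq_iff_of_sq_le one_pos (D.randersForm_sq_le x v),
    isVelocity_iff, ← sub_eq_zero, ← mul_eq_zero_iff_left hgap, hsphere, sub_eq_zero]

theorem randersNorm_pos (x : M) {v : Tan n x} (hv : v ≠ 0) : 0 < D.randersNorm x v := by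
  have h : D.randersForm x v ^ 2 < D.randersMetric.inner x v v := by
    rw [randersMetric_inner_self]
    exact lt_add_of_pos_left _ (mul_pos (inv_pos.mpr (D.gap_pos x)) (D.h.pos x v hv))
  exact neg_lt_iff_pos_add'.mp (Real.neg_sqrt_lt_of_sq_lt h)

theorem randersNorm_nonneg (x : M) (v : Tan n x) : 0 ≤ D.randersNorm x v :=
  neg_le_iff_add_nonneg'.mp (Real.neg_sqrt_le_of_sq_le (D.randersForm_sq_le x v))

theorem randersNorm_smul (x : M) {c : ℝ} (hc : 0 ≤ c) (v : Tan n x) :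
    D.randersNorm x (c • v) = c * D.randersNorm x v := by
  simp only [randersNorm, hnorm_smul _ _ hc, map_smul, smul_eq_mul, mul_add]

theorem continuous_randersNorm :
    Continuous (fun p : TangentBundle (𝓡 n) M => D.randersNorm p.1 p.2) :=
  (continuous_inner_self D.randersMetric).sqrt.add D.isContMDiffForm_randersForm.continuous

theorem wind_eq_zero_of_randersNorm_neg (hneg : ∀ x v, D.randersNorm x (-v) = D.randersNorm x v)
    (x : M) : D.W x = 0 := by
  have hform : D.randersForm x (D.W x) = 0 := by
    have := hneg x (D.W x)
    simp only [randersNorm, hnorm_neg, map_neg] at this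
    linarith
  by_contra hW
  have hpos := mul_pos (inv_pos.mpr (D.gap_pos x)) (D.h.pos x _ hW)
  rw [randersForm_apply, neg_eq_zero] at hform
  exact hpos.ne' hform

theorem randersNorm_of_wind_eq_zero {x : M} (hW : D.W x = 0) (v : Tan n x) :
    D.randersNorm x v = (D.speed x)⁻¹ * hnorm D.h x v := by
  have hs := D.speed_pos x
  rw [randersNorm, hnorm, randersMetric_inner_self]
  simp [randersForm_apply, hW, hnorm, gap, Real.sqrt_mul (inv_nonneg.mpr (sq_nonneg _)),
    Real.sqrt_inv, Real.sqrt_sq hs.le]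

end NavigationData

theorem inner_smul_sharp {a h : RiemMetric n M} {x : M} {β : Tan n x →L[ℝ] ℝ} {V : Tan n x}
    {c : ℝ} (hV : a.inner x V = β) (hβV : β V ≠ 1)
    (hh : ∀ v w, h.inner x v w = c * (a.inner x v w - β v * β w)) (w : Tan n x) :
    h.inner x (-(1 - β V)⁻¹ • V) w = -(c * β w) := by
  have hε : 1 - β V ≠ 0 := sub_ne_zero.mpr hβV.symm
  simp only [hh, map_smul, smul_apply, hV, smul_eq_mul]
  field_simp

theorem NavigationData.randersNorm_eq_of_sharp (D : NavigationData n M) {x : M}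
    {a : RiemMetric n M} {β : Tan n x →L[ℝ] ℝ} {V : Tan n x}
    (hV : a.inner x V = β) (hβV : β V < 1) (hW : D.W x = -(1 - β V)⁻¹ • V)
    (hh : ∀ v w, D.h.inner x v w =
      D.speed x ^ 2 * (1 - β V) * (a.inner x v w - β v * β w)) (v : Tan n x) :
    D.randersNorm x v = hnorm a x v + β v := by
  have hε : 1 - β V ≠ 0 := (sub_pos.mpr hβV).ne'
  have hs := (D.speed_pos x).ne'
  have hhW (w : Tan n x) : D.h.inner x (D.W x) w = -(D.speed x ^ 2 * (1 - β V) * β w) := by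
    rw [hW, inner_smul_sharp hV hβV.ne hh]
  have hgap : D.gap x = D.speed x ^ 2 * (1 - β V) := by
    rw [gap, hhW, hW, map_smul, smul_eq_mul]
    field_simp
  have hform : D.randersForm x v = β v := by
    rw [randersForm_apply, hhW, hgap]
    field_simp
  have hmetric : D.randersMetric.inner x v v = a.inner x v v := by
    rw [randersMetric_inner_self, hform, hh, hgap]
    field_simp
    ring_nf
  rw [randersNorm, hnorm, hmetric, hform, hnorm]

theorem apply_sharp_lt_one {a : RiemMetric n M} {x : M} {β : Tan n x →L[ℝ] ℝ} {V : Tan n x}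
    (hV : a.inner x V = β) (hpos : ∀ v, v ≠ 0 → 0 < hnorm a x v + β v) : β V < 1 := by
  rcases eq_or_ne V 0 with rfl | hV₀
  · simp
  have hβV : 0 < β V := hV ▸ a.pos x V hV₀
  have h := hpos (-V) (neg_ne_zero.mpr hV₀)
  rw [hnorm_neg, map_neg, ← sub_eq_add_neg, sub_pos, hnorm, hV, Real.lt_sqrt hβV.le] at h
  exact lt_of_mul_lt_mul_left (by rwa [← sq, mul_one]) hβV.le

theorem exists_navigationData_of_randers (a : RiemMetric n M) {β : ∀ x : M, Tan n x →L[ℝ] ℝ}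
    (hβ : IsContMDiffForm (𝓡 n) ∞ (Model n) β)
    (hpos : ∀ x v, v ≠ 0 → 0 < hnorm a x v + β x v) {s : M → ℝ}
    (hs : ContMDiff (𝓡 n) 𝓘(ℝ, ℝ) ∞ s) (hs₀ : ∀ x, 0 < s x) (hs₁ : ∀ x, s x ≤ 1) :
    ∃ D : NavigationData n M, D.speed = s ∧ ∀ x v, D.randersNorm x v = hnorm a x v + β x v := by
  obtain ⟨V, hV, haV⟩ := exists_sharp a hβ
  have hβV : ∀ x, β x (V x) < 1 := fun x => apply_sharp_lt_one (haV x) (hpos x)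
  have hε₀ : ∀ x, 0 < 1 - β x (V x) := fun x => sub_pos.mpr (hβV x)
  have hε : ContMDiff (𝓡 n) 𝓘(ℝ, ℝ) ∞ (fun x => 1 - β x (V x)) :=
    contMDiff_const.sub (hβ.contMDiff_apply hV)
  have hp : ContMDiff (𝓡 n) 𝓘(ℝ, ℝ) ∞ (fun x => s x ^ 2 * (1 - β x (V x))) := (hs.pow 2).mul hε
  have hp₀ (x : M) : 0 < s x ^ 2 * (1 - β x (V x)) := mul_pos (pow_pos (hs₀ x) 2) (hε₀ x)
  have hle (x : M) (v : Tan n x) :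
      s x ^ 2 * (1 - β x (V x)) * (1 - β x (V x)) * a.inner x v v ≤
        s x ^ 2 * (1 - β x (V x)) * a.inner x v v + -(s x ^ 2 * (1 - β x (V x))) * β x v ^ 2 := by
    have hcs := inner_sq_le a x (V x) v
    rw [haV] at hcs
    linarith [mul_le_mul_of_nonneg_left hcs (hp₀ x).le]
  let h := perturbMetric a hβ hp hp.neg (fun x => mul_pos (hp₀ x) (hε₀ x)) hle
  have hh (x : M) (v w : Tan n x) : h.inner x v w =
      s x ^ 2 * (1 - β x (V x)) * (a.inner x v w - β x v * β x w) := by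
    rw [perturbMetric_inner]
    ring
  have hW := ContMDiff.smul_section (V := fun x : M => TangentSpace (𝓡 n) x)
    (hε.inv₀ fun x => (hε₀ x).ne').neg hV
  have hlt (x : M) : hnorm h x (-(1 - β x (V x))⁻¹ • V x) < s x := by
    rw [hnorm, Real.sqrt_lt' (hs₀ x), inner_smul_sharp (haV x) (hβV x).ne (hh x), map_smul,
      smul_eq_mul, neg_mul, mul_neg, neg_neg, mul_assoc, mul_inv_cancel_left₀ (hε₀ x).ne']
    exact mul_lt_of_lt_one_right (pow_pos (hs₀ x) 2) (hβV x)
  let D : NavigationData n M := ⟨h, _, hW, s, hs, hs₁, hlt⟩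
  exact ⟨D, rfl, fun x v => D.randersNorm_eq_of_sharp (haV x) (hβV x) rfl (hh x) v⟩

namespace FinslerMetric

variable {F : FinslerMetric n M} {D : NavigationData n M}
  (hF : ∀ x v, F.toFun x v = D.randersNorm x v)

include hF

theorem isRanders_of_eq_randersNorm : F.IsRanders :=
  ⟨D.randersMetric, D.randersForm, D.isContMDiffForm_randersForm, hF⟩

theorem wind_eq_zero_of_neg (hneg : ∀ x v, F.toFun x (-v) = F.toFun x v) (x : M) : D.W x = 0 :=
  D.wind_eq_zero_of_randersNorm_neg (fun x v => by rw [← hF, ← hF, hneg]) x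

theorem isRiemannian_iff_wind_eq_zero : F.IsRiemannian ↔ ∀ x, D.W x = 0 := by
  refine ⟨fun ⟨g, hg⟩ => wind_eq_zero_of_neg hF fun x v => by rw [hg, hg, hnorm_neg],
    fun hW => ⟨D.randersMetric, fun x v => ?_⟩⟩
  simp [hF, NavigationData.randersNorm, NavigationData.randersForm, hW x]

theorem isConformalTo_iff_wind_eq_zero : F.IsConformalTo D.h ↔ ∀ x, D.W x = 0 := by
  refine ⟨fun ⟨ρ, _, _, hρ⟩ => wind_eq_zero_of_neg hF fun x v => ?_,
    fun hW => ⟨fun x => ((D.speed x)⁻¹) ^ 2, ?_, ?_, fun x v => ?_⟩⟩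
  · rw [← sq_eq_sq₀ (hF x (-v) ▸ D.randersNorm_nonneg x (-v)) (hF x v ▸ D.randersNorm_nonneg x v),
      hρ, hρ]
    simp
  · exact (D.contMDiff_speed.inv₀ fun x => (D.speed_pos x).ne').pow 2
  · exact fun x => pow_pos (inv_pos.mpr (D.speed_pos x)) 2
  · rw [hF, D.randersNorm_of_wind_eq_zero (hW x), mul_pow, hnorm,
      Real.sq_sqrt (inner_self_nonneg D.h x v)]

theorem isScalingOf_iff_wind_eq_zero_and_speed [NeZero n] : F.IsScalingOf D.h ↔
    (∀ x, D.W x = 0) ∧ ∃ k : ℝ, ∀ x, D.speed x ^ 2 = k := by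
  constructor
  · rintro ⟨c, -, hc⟩
    have hW := wind_eq_zero_of_neg hF fun x v => by rw [hc, hc, hnorm_neg]
    refine ⟨hW, c⁻¹ ^ 2, fun x => ?_⟩
    obtain ⟨v, hv⟩ : ∃ v : Tan n x, v ≠ 0 := exists_ne (0 : Model n)
    have hcv := hc x v
    rw [hF, D.randersNorm_of_wind_eq_zero (hW x), mul_left_inj' (hnorm_pos D.h x hv).ne'] at hcv
    rw [← hcv, inv_inv]
  · rintro ⟨hW, k, hk⟩
    rcases isEmpty_or_nonempty M with _ | ⟨⟨x₀⟩⟩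
    · exact ⟨1, one_pos, isEmptyElim⟩
    refine ⟨(D.speed x₀)⁻¹, inv_pos.mpr (D.speed_pos x₀), fun x v => ?_⟩
    have hspeed : D.speed x = D.speed x₀ := by
      rw [← sq_eq_sq₀ (D.speed_pos x).le (D.speed_pos x₀).le, hk, hk]
    rw [hF, D.randersNorm_of_wind_eq_zero (hW x), hspeed]

end FinslerMetric

end RandersNorm

open MeasureTheory Filter Topology

section RealAnalysis

variable {E : Type*} [NormedAddCommGroup E] {f g : ℝ → E} {S : Set ℝ}

theorem intervalIntegrable_of_finite_breaks (hS : S.Finite) {a b : ℝ} (hab : a ≤ b)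
    (h : ∀ c d, a ≤ c → c < d → d ≤ b → Disjoint (Ioo c d) S → IntervalIntegrable f volume c d) :
    IntervalIntegrable f volume a b := by
  induction S, hS using Set.Finite.induction_on generalizing a b with
  | empty =>
    rcases hab.eq_or_lt with rfl | hab
    · exact IntervalIntegrable.refl
    · exact h a b le_rfl hab le_rfl (disjoint_empty _)
  | @insert s S _ _ ih =>
    by_cases hs : s ∈ Ioo a b
    · refine (ih hs.1.le fun c d hc hcd hd hdis => ?_).trans
        (ih hs.2.le fun c d hc hcd hd hdis => ?_)
      · exact h c d hc hcd (hd.trans hs.2.le) (disjoint_insert_right.mpr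
          ⟨fun hsc => (hsc.2.trans_le hd).false, hdis⟩)
      · exact h c d (hs.1.le.trans hc) hcd hd (disjoint_insert_right.mpr
          ⟨fun hsc => (hc.trans_lt hsc.1).false, hdis⟩)
    · exact ih hab fun c d hc hcd hd hdis => h c d hc hcd hd (disjoint_insert_right.mpr
        ⟨fun hsc => hs (Ioo_subset_Ioo hc hd hsc), hdis⟩)

variable [NormedSpace ℝ E]

theorem integral_congr_off_countable (hS : S.Countable) {a b : ℝ} (hab : a ≤ b)
    (hfg : EqOn f g (Ioo a b \ S)) : ∫ t in a..b, f t = ∫ t in a..b, g t := by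
  rw [intervalIntegral.integral_of_le hab, intervalIntegral.integral_of_le hab,
    integral_Ioc_eq_integral_Ioo, integral_Ioc_eq_integral_Ioo]
  refine setIntegral_congr_ae measurableSet_Ioo ?_
  filter_upwards [hS.ae_notMem volume] with t htS ht using hfg ⟨ht, htS⟩

theorem hasDerivWithinAt_primitive [CompleteSpace E] {a b t : ℝ} (hg : ContinuousOn g (Icc a b))
    (hfg : EqOn f g (Ioo a b)) (ht : t ∈ Icc a b) :
    HasDerivWithinAt (fun u => ∫ s in a..u, f s) (g t) (Icc a b) t := by
  have : Fact (t ∈ Icc a b) := ⟨ht⟩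
  have hint : IntervalIntegrable g volume a t :=
    (hg.mono (Icc_subset_Icc_right ht.2)).intervalIntegrable_of_Icc ht.1
  have hG := intervalIntegral.integral_hasDerivWithinAt_right hint (s := Icc a b)
    (hg.stronglyMeasurableAtFilter_nhdsWithin measurableSet_Icc t) (hg t ht)
  refine hG.congr_of_mem (fun u hu => ?_) ht
  exact intervalIntegral.integral_congr_Ioo_of_le hu.1 (hfg.mono (Ioo_subset_Ioo_right hu.2))

theorem eq_of_forall_integral_eq_smul [CompleteSpace E] {a b : ℝ} {v : E} (hab : a < b)
    (hf : ContinuousOn f (Icc a b)) (h : ∀ τ ∈ Ioc a b, ∫ t in a..τ, f t = (τ - a) • v) :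
    f a = v := by
  have ha : a ∈ Icc a b := left_mem_Icc.mpr hab.le
  have hlin : HasDerivWithinAt (fun τ => (τ - a) • v) v (Icc a b) a := by
    simpa using (((hasDerivAt_id a).sub_const a).smul_const v).hasDerivWithinAt
  have hprim := hasDerivWithinAt_primitive hf (eqOn_refl f _) ha
  refine (uniqueDiffOn_Icc hab a ha).eq_deriv _ (hprim.congr_of_mem (fun τ hτ => ?_) ha) hlin
  rcases hτ.1.eq_or_lt with rfl | haτ
  · simp
  · exact (h τ ⟨haτ, hτ.2⟩).symm

theorem exists_orderIso_primitive {f : ℝ → ℝ} (hf : Integrable (fun t => f t - 1))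
    (hpos : ∀ t, 0 < f t) (a : ℝ) : ∃ L : ℝ ≃o ℝ, ∀ t, L t = ∫ s in a..t, f s := by
  have hint (c d : ℝ) : IntervalIntegrable f volume c d := by
    simpa using hf.intervalIntegrable.add (intervalIntegrable_const (c := (1 : ℝ)))
  have hmono : StrictMono (fun t => ∫ s in a..t, f s) := fun c d hcd => by
    rw [← sub_pos, intervalIntegral.integral_interval_sub_left (hint a d) (hint a c)]
    exact intervalIntegral.intervalIntegral_pos_of_pos (hint c d) hpos hcd
  have hbound (t : ℝ) : |(∫ s in a..t, f s) - (t - a)| ≤ ∫ s, |f s - 1| := by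
    have hsub : (∫ s in a..t, f s) - (t - a) = ∫ s in a..t, (f s - 1) := by
      simp [intervalIntegral.integral_sub (hint a t) intervalIntegrable_const]
    rw [hsub]
    exact intervalIntegral.norm_integral_le_integral_norm_uIoc.trans
      (setIntegral_le_integral hf.norm (Eventually.of_forall fun s => norm_nonneg _))
  have htop : Tendsto (fun t => ∫ s in a..t, f s) atTop atTop :=
    tendsto_atTop_mono (fun t => by linarith [id_eq t, (abs_le.mp (hbound t)).1])
      (tendsto_atTop_add_const_right _ (-a - ∫ s, |f s - 1|) tendsto_id)
  have hbot : Tendsto (fun t => ∫ s in a..t, f s) atBot atBot :=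
    tendsto_atBot_mono (fun t => by linarith [id_eq t, (abs_le.mp (hbound t)).2])
      (tendsto_atBot_add_const_right _ (-a + ∫ s, |f s - 1|) tendsto_id)
  exact ⟨hmono.orderIsoOfSurjective _
    ((intervalIntegral.continuous_primitive hint a).surjective htop hbot), fun t => rfl⟩

/-- Continued by the constant `1`, the integrand has a primitive that is a bijection of `ℝ`. -/
theorem exists_orderIso_primitive_on {f : ℝ → ℝ} {a b : ℝ} (hS : S.Countable)
    (hf : IntervalIntegrable f volume a b) (hpos : ∀ t ∈ Ioo a b \ S, 0 < f t) :
    ∃ L : ℝ ≃o ℝ, ∀ t ∈ Icc a b, L t = ∫ s in a..t, f s := by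
  classical
  have hmeas : MeasurableSet (Ioo a b \ S) := measurableSet_Ioo.diff hS.measurableSet
  have hsub : Ioo a b \ S ⊆ uIoc a b :=
    sdiff_subset.trans (Ioo_subset_Ioc_self.trans Ioc_subset_uIoc)
  have hint : Integrable (fun t => (Ioo a b \ S).piecewise f 1 t - 1) := by
    have hind : (fun t => (Ioo a b \ S).piecewise f 1 t - 1) =
        (Ioo a b \ S).indicator (fun t => f t - 1) := by
      ext t
      by_cases ht : t ∈ Ioo a b \ S <;> simp [ht]
    rw [hind, integrable_indicator_iff hmeas]
    exact (hf.sub intervalIntegrable_const).def'.mono_set hsub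
  have hpos' (t : ℝ) : 0 < (Ioo a b \ S).piecewise f 1 t := by
    by_cases ht : t ∈ Ioo a b \ S
    · simpa [ht] using hpos t ht
    · simp [ht]
  obtain ⟨L, hL⟩ := exists_orderIso_primitive hint hpos' a
  refine ⟨L, fun t ht => (hL t).trans (integral_congr_off_countable hS ht.1 fun s hs => ?_)⟩
  exact piecewise_eq_of_mem _ _ _ ⟨Ioo_subset_Ioo_right ht.2 hs.1, hs.2⟩

theorem hasDerivWithinAt_homeomorph_symm {𝕜 : Type*} [NontriviallyNormedField 𝕜] (L : 𝕜 ≃ₜ 𝕜)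
    {s : Set 𝕜} {t r : 𝕜} (hL : HasDerivWithinAt L r s t) (hr : r ≠ 0) (ht : t ∈ s) :
    HasDerivWithinAt L.symm r⁻¹ (L '' s) (L t) := by
  have hmaps : MapsTo L.symm (L '' s) s := by
    rintro _ ⟨u, hu, rfl⟩
    simpa using hu
  have hcont : Tendsto L.symm (𝓝[L '' s] (L t)) (𝓝[s] (L.symm (L t))) :=
    L.symm.continuous.continuousWithinAt.tendsto_nhdsWithin hmaps
  rw [← L.symm_apply_apply t] at hL
  simpa using (hL.hasFDerivWithinAt.of_comp_of_leftInverse (f'symm := .toSpanSingleton 𝕜 r⁻¹)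
    hcont (hasFDerivWithinAt_id (L t) _) (Eventually.of_forall L.apply_symm_apply)
    (fun v => by simp [hr]) (mem_image_of_mem L ht)).hasDerivWithinAt

theorem hasDerivWithinAt_orderIso_symm {L : ℝ ≃o ℝ} {c d r τ : ℝ}
    (hL : HasDerivWithinAt L r (Icc c d) (L.symm τ)) (hr : r ≠ 0) (hτ : τ ∈ Icc (L c) (L d)) :
    HasDerivWithinAt L.symm r⁻¹ (Icc (L c) (L d)) τ := by
  have hsymm := hasDerivWithinAt_homeomorph_symm L.toHomeomorph (s := Icc c d) hL hr
    ((L.symm.preimage_Icc c d).ge hτ)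
  simpa using hsymm

theorem contDiffOn_orderIso_symm {L : ℝ ≃o ℝ} {g : ℝ → ℝ} {c d : ℝ} (hcd : c < d)
    (hL : ∀ t ∈ Icc c d, HasDerivWithinAt L (g t) (Icc c d) t) (hg : ContinuousOn g (Icc c d))
    (hg₀ : ∀ t ∈ Icc c d, g t ≠ 0) : ContDiffOn ℝ 1 L.symm (Icc (L c) (L d)) := by
  have hu := uniqueDiffOn_Icc (L.lt_iff_lt.mpr hcd)
  have hmaps : MapsTo L.symm (Icc (L c) (L d)) (Icc c d) := (L.symm.preimage_Icc c d).ge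
  have hderiv {τ : ℝ} (hτ : τ ∈ Icc (L c) (L d)) :=
    hasDerivWithinAt_orderIso_symm (hL _ (hmaps hτ)) (hg₀ _ (hmaps hτ)) hτ
  refine (contDiffOn_one_iff_derivWithin hu).mpr
    ⟨fun τ hτ => (hderiv hτ).differentiableWithinAt, ?_⟩
  exact ((hg.comp L.symm.continuous.continuousOn hmaps).inv₀ fun τ hτ => hg₀ _ (hmaps hτ)).congr
    fun τ hτ => (hderiv hτ).derivWithin (hu τ hτ)

theorem exists_Icc_disjoint (hS : IsClosed S) {a b t : ℝ} (ht : t ∈ Ioo a b \ S) :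
    ∃ c d, a ≤ c ∧ t ∈ Ioo c d ∧ d ≤ b ∧ Disjoint (Ioo c d) S := by
  obtain ⟨c, d, htcd, hcd⟩ := mem_nhds_iff_exists_Ioo_subset.mp
    ((isOpen_Ioo.sdiff hS).mem_nhds ht)
  have hlt := htcd.1.trans htcd.2
  obtain ⟨hac, hdb⟩ := (Ioo_subset_Ioo_iff hlt).mp fun u hu => (hcd hu).1
  exact ⟨c, d, hac, htcd, hdb, disjoint_left.mpr fun u hu => (hcd hu).2⟩

end RealAnalysis

section Velocity

variable {E : Type*} [NormedAddCommGroup E] [NormedSpace ℝ E] {H : Type*} [TopologicalSpace H]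
  {I : ModelWithCorners ℝ E H} {M : Type*} [TopologicalSpace M] [ChartedSpace H M]

variable (I) in
/-- The velocity at time `t` of a path defined on `[a, b]`, one-sided at the end points. -/
noncomputable def velocity (γ : ℝ → M) (a b t : ℝ) : TangentSpace I (γ t) :=
  mfderivWithin 𝓘(ℝ, ℝ) I γ (Icc a b) t (1 : ℝ)

theorem velocity_eq_mfderiv (γ : ℝ → M) {a b t : ℝ} (ht : t ∈ Ioo a b) :
    velocity I γ a b t = mfderiv 𝓘(ℝ, ℝ) I γ t (1 : ℝ) := by
  rw [velocity, mfderivWithin_of_mem_nhds (Icc_mem_nhds ht.1 ht.2)]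

theorem velocity_eq_of_hasDerivWithinAt {γ : ℝ → E} {v : E} {a b t : ℝ} (hab : a < b)
    (ht : t ∈ Icc a b) (hγ : HasDerivWithinAt γ v (Icc a b) t) :
    velocity 𝓘(ℝ, E) γ a b t = v := by
  rw [velocity, mfderivWithin_eq_fderivWithin]
  exact hγ.derivWithin (uniqueDiffOn_Icc hab t ht)

theorem velocity_comp {E' : Type*} [NormedAddCommGroup E'] [NormedSpace ℝ E'] {f : E' → M}
    {u : Set E'} {l : ℝ → E'} {v : E'} {a b t : ℝ} (hab : a < b) (ht : t ∈ Icc a b)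
    (hf : MDifferentiableWithinAt 𝓘(ℝ, E') I f u (l t))
    (hl : HasDerivWithinAt l v (Icc a b) t) (hmaps : MapsTo l (Icc a b) u) :
    velocity I (f ∘ l) a b t = mfderivWithin 𝓘(ℝ, E') I f u (l t) v := by
  have hlm : MDifferentiableWithinAt 𝓘(ℝ, ℝ) 𝓘(ℝ, E') l (Icc a b) t :=
    hl.differentiableWithinAt.mdifferentiableWithinAt
  rw [velocity, mfderivWithin_comp t hf hlm hmaps ((uniqueDiffOn_Icc hab).uniqueMDiffOn t ht)]
  exact congrArg (mfderivWithin 𝓘(ℝ, E') I f u (l t))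
    (velocity_eq_of_hasDerivWithinAt hab ht hl)

theorem velocity_comp_real {γ : ℝ → M} {φ : ℝ → ℝ} {a b c d τ r : ℝ} (hcd : c < d)
    (hτ : τ ∈ Icc c d) (hγ : MDifferentiableWithinAt 𝓘(ℝ, ℝ) I γ (Icc a b) (φ τ))
    (hφ : HasDerivWithinAt φ r (Icc c d) τ) (hmaps : MapsTo φ (Icc c d) (Icc a b)) :
    velocity I (γ ∘ φ) c d τ = r • velocity I γ a b (φ τ) := by
  rw [velocity_comp hcd hτ hγ hφ hmaps]
  exact (congrArg (mfderivWithin 𝓘(ℝ, ℝ) I γ (Icc a b) (φ τ)) (mul_one r).symm).trans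
    (map_smul _ r (1 : ℝ))

theorem continuousOn_velocity [IsManifold I 1 M] {γ : ℝ → M} {a b : ℝ} (hab : a < b)
    (hγ : ContMDiffOn 𝓘(ℝ, ℝ) I 1 γ (Icc a b)) :
    ContinuousOn (fun t => (⟨γ t, velocity I γ a b t⟩ : TangentBundle I M)) (Icc a b) := by
  have hone : Continuous (fun t : ℝ => (⟨t, (1 : ℝ)⟩ : TangentBundle 𝓘(ℝ, ℝ) ℝ)) :=
    (tangentBundleModelSpaceHomeomorph 𝓘(ℝ, ℝ)).symm.continuous.comp
      (continuous_id.prodMk continuous_const)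
  exact (hγ.continuousOn_tangentMapWithin le_rfl (uniqueDiffOn_Icc hab).uniqueMDiffOn).comp
    hone.continuousOn fun t ht => ht

variable (I) in
/-- `γ` is `C¹` on every interval `[c, d] ⊆ [a, b]` with no point of `S` in its interior, and its
velocities there satisfy `P`. This is the condition in `IsPathWith` for a fixed set `S` of break
points, and for an arbitrary model space. -/
def IsPathOff (γ : ℝ → M) (a b : ℝ) (S : Set ℝ) (P : ∀ x : M, TangentSpace I x → Prop) : Prop :=
  ∀ c d : ℝ, a ≤ c → c < d → d ≤ b → Disjoint (Ioo c d) S →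
    ContMDiffOn 𝓘(ℝ, ℝ) I 1 γ (Icc c d) ∧ ∀ t ∈ Icc c d, P (γ t) (velocity I γ c d t)

namespace IsPathOff

variable {γ : ℝ → M} {a b : ℝ} {S : Set ℝ} {P Q : ∀ x : M, TangentSpace I x → Prop}

theorem imp (hγ : IsPathOff I γ a b S P) (hPQ : ∀ x v, P x v → Q x v) :
    IsPathOff I γ a b S Q := fun c d hc hcd hd hdis =>
  ⟨(hγ c d hc hcd hd hdis).1, fun t ht => hPQ _ _ ((hγ c d hc hcd hd hdis).2 t ht)⟩

theorem mono {a' b' : ℝ} (hγ : IsPathOff I γ a b S P) (ha : a ≤ a') (hb : b' ≤ b) :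
    IsPathOff I γ a' b' S P :=
  fun c d hc hcd hd => hγ c d (ha.trans hc) hcd (hd.trans hb)

theorem apply_mfderiv (hγ : IsPathOff I γ a b S P) (hS : IsClosed S) {t : ℝ}
    (ht : t ∈ Ioo a b \ S) :
    P (γ t) (mfderiv 𝓘(ℝ, ℝ) I γ t (1 : ℝ)) := by
  obtain ⟨c, d, hc, htcd, hd, hdis⟩ := exists_Icc_disjoint hS ht
  rw [← velocity_eq_mfderiv γ htcd]
  exact (hγ c d hc (htcd.1.trans htcd.2) hd hdis).2 t (Ioo_subset_Icc_self htcd)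

theorem integral_eq_sub {N : ∀ x : M, TangentSpace I x → ℝ}
    (hγ : IsPathOff I γ a b S (fun x v => N x v = 1)) (hab : a ≤ b) (hS : S.Finite) :
    ∫ t in a..b, N (γ t) (mfderiv 𝓘(ℝ, ℝ) I γ t (1 : ℝ)) = b - a := by
  rw [integral_congr_off_countable (g := fun _ => (1 : ℝ)) hS.countable hab
    fun t ht => hγ.apply_mfderiv hS.isClosed ht]
  simp

end IsPathOff

end Velocity

section ArcLength

variable {E : Type*} [NormedAddCommGroup E] [NormedSpace ℝ E] {H : Type*} [TopologicalSpace H]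
  {I : ModelWithCorners ℝ E H} {M : Type*} [TopologicalSpace M] [ChartedSpace H M]

variable (I) in
/-- Continuous Finsler functions: positively homogeneous functions on the tangent bundle that are
continuous and positive off the zero section. Both a Finsler metric and the Randers norm of
navigation data are of this kind, and paths can be parametrized by their length. -/
structure IsContinuousFinsler [IsManifold I 1 M] (N : ∀ x : M, TangentSpace I x → ℝ) : Prop where
  continuousOn : ContinuousOn (fun p : TangentBundle I M => N p.1 p.2) {p | p.2 ≠ 0}
  pos (x : M) (v : TangentSpace I x) : v ≠ 0 → 0 < N x v
  smul (x : M) (c : ℝ) (v : TangentSpace I x) : 0 < c → N x (c • v) = c * N x v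

/-- `L` is an arc length parameter, with respect to `N`, of the path `γ` on `[a, b]` with break
points `S`. -/
def IsArcLength (N : ∀ x : M, TangentSpace I x → ℝ) (γ : ℝ → M) (a b : ℝ) (S : Set ℝ)
    (L : ℝ ≃o ℝ) : Prop :=
  ∀ c d : ℝ, a ≤ c → c < d → d ≤ b → Disjoint (Ioo c d) S →
    ∀ t ∈ Icc c d, HasDerivWithinAt L (N (γ t) (velocity I γ c d t)) (Icc c d) t

variable [IsManifold I 1 M] {N N' : ∀ x : M, TangentSpace I x → ℝ}
  {γ : ℝ → M} {a b : ℝ} {S : Set ℝ}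

namespace IsContinuousFinsler

theorem zero (hN : IsContinuousFinsler I N) (x : M) : N x 0 = 0 := by
  have h := hN.smul x 2 0 two_pos
  rw [smul_zero] at h
  linarith

theorem ne_zero (hN : IsContinuousFinsler I N) {x : M} {v : TangentSpace I x} (hv : N x v = 1) :
    v ≠ 0 := by
  rintro rfl
  exact zero_ne_one ((hN.zero x).symm.trans hv)

theorem inv_smul (hN : IsContinuousFinsler I N) {x : M} {v : TangentSpace I x} (hv : v ≠ 0) :
    N x ((N x v)⁻¹ • v) = 1 := by
  rw [hN.smul x _ v (inv_pos.mpr (hN.pos x v hv)), inv_mul_cancel₀ (hN.pos x v hv).ne']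

theorem eq_of_forall_eq_one (hN : IsContinuousFinsler I N) (hN' : IsContinuousFinsler I N')
    (h : ∀ x v, N x v = 1 → N' x v = 1) (x : M) (v : TangentSpace I x) : N' x v = N x v := by
  rcases eq_or_ne v 0 with rfl | hv
  · rw [hN.zero, hN'.zero]
  have hunit := h x _ (hN.inv_smul hv)
  rwa [hN'.smul x _ v (inv_pos.mpr (hN.pos x v hv)), inv_mul_eq_one₀ (hN.pos x v hv).ne',
    eq_comm] at hunit

theorem continuousOn_speed (hN : IsContinuousFinsler I N) (hab : a < b)
    (hγ : ContMDiffOn 𝓘(ℝ, ℝ) I 1 γ (Icc a b)) (h₀ : ∀ t ∈ Icc a b, velocity I γ a b t ≠ 0) :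
    ContinuousOn (fun t => N (γ t) (velocity I γ a b t)) (Icc a b) :=
  hN.continuousOn.comp (continuousOn_velocity hab hγ) h₀

theorem intervalIntegrable_speed (hN : IsContinuousFinsler I N) (hab : a ≤ b) (hS : S.Finite)
    (hγ : IsPathOff I γ a b S (fun _ v => v ≠ 0)) :
    IntervalIntegrable (fun t => N (γ t) (mfderiv 𝓘(ℝ, ℝ) I γ t (1 : ℝ))) volume a b := by
  refine intervalIntegrable_of_finite_breaks hS hab fun c d hc hcd hd hdis => ?_
  obtain ⟨hγcd, h₀⟩ := hγ c d hc hcd hd hdis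
  refine ((hN.continuousOn_speed hcd hγcd h₀).intervalIntegrable_of_Icc hcd.le).congr_uIoo ?_
  rw [uIoo_of_le hcd.le]
  exact fun t ht => congrArg (N (γ t)) (velocity_eq_mfderiv γ ht)

theorem exists_isArcLength (hN : IsContinuousFinsler I N) (hab : a ≤ b) (hS : S.Finite)
    (hγ : IsPathOff I γ a b S (fun _ v => v ≠ 0)) :
    ∃ L : ℝ ≃o ℝ, L a = 0 ∧ L b = ∫ t in a..b, N (γ t) (mfderiv 𝓘(ℝ, ℝ) I γ t (1 : ℝ)) ∧
      IsArcLength N γ a b S L := by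
  have hint {p q : ℝ} (hp : a ≤ p) (hpq : p ≤ q) (hq : q ≤ b) :=
    hN.intervalIntegrable_speed hpq hS (hγ.mono hp hq)
  obtain ⟨L, hL⟩ := exists_orderIso_primitive_on hS.countable (hint le_rfl hab le_rfl)
    fun t ht => hN.pos _ _ (hγ.apply_mfderiv hS.isClosed ht)
  refine ⟨L, by simp [hL a (left_mem_Icc.mpr hab)], hL b (right_mem_Icc.mpr hab),
    fun c d hc hcd hd hdis t ht => ?_⟩
  obtain ⟨hγcd, h₀⟩ := hγ c d hc hcd hd hdis
  have hprim := hasDerivWithinAt_primitive (hN.continuousOn_speed hcd hγcd h₀)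
    (fun u hu => congrArg (N (γ u)) (velocity_eq_mfderiv γ hu).symm) ht
  refine (hprim.const_add (L c)).congr_of_mem (fun u hu => ?_) ht
  have hub := hu.2.trans hd
  rw [hL c ⟨hc, hcd.le.trans hd⟩, hL u ⟨hc.trans hu.1, hub⟩,
    intervalIntegral.integral_add_adjacent_intervals (hint le_rfl hc (hu.1.trans hub))
      (hint hc hu.1 hub)]

end IsContinuousFinsler

namespace IsArcLength

variable {L : ℝ ≃o ℝ}

theorem hasDerivWithinAt_symm (hL : IsArcLength N γ a b S L) (hN : IsContinuousFinsler I N)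
    (hγ : IsPathOff I γ a b S (fun _ v => v ≠ 0)) {c d τ : ℝ} (hc : a ≤ c) (hcd : c < d)
    (hd : d ≤ b) (hdis : Disjoint (Ioo c d) S) (hτ : τ ∈ Icc (L c) (L d)) :
    HasDerivWithinAt L.symm (N (γ (L.symm τ)) (velocity I γ c d (L.symm τ)))⁻¹
      (Icc (L c) (L d)) τ := by
  have hmem : L.symm τ ∈ Icc c d := (L.symm.preimage_Icc c d).ge hτ
  exact hasDerivWithinAt_orderIso_symm (hL c d hc hcd hd hdis _ hmem)
    (hN.pos _ _ ((hγ c d hc hcd hd hdis).2 _ hmem)).ne' hτ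

theorem velocity_comp_symm (hL : IsArcLength N γ a b S L) (hN : IsContinuousFinsler I N)
    (hγ : IsPathOff I γ a b S (fun _ v => v ≠ 0)) {c d τ : ℝ} (hc : a ≤ c) (hcd : c < d)
    (hd : d ≤ b) (hdis : Disjoint (Ioo c d) S) (hτ : τ ∈ Icc (L c) (L d)) :
    velocity I (γ ∘ L.symm) (L c) (L d) τ =
      (N (γ (L.symm τ)) (velocity I γ c d (L.symm τ)))⁻¹ • velocity I γ c d (L.symm τ) := by
  have hmaps : MapsTo L.symm (Icc (L c) (L d)) (Icc c d) := (L.symm.preimage_Icc c d).ge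
  exact velocity_comp_real (L.strictMono hcd) hτ
    (((hγ c d hc hcd hd hdis).1 _ (hmaps hτ)).mdifferentiableWithinAt one_ne_zero)
    (hL.hasDerivWithinAt_symm hN hγ hc hcd hd hdis hτ) hmaps

theorem isPathOff_comp_symm (hL : IsArcLength N γ a b S L) (hN : IsContinuousFinsler I N)
    (hγ : IsPathOff I γ a b S (fun _ v => v ≠ 0)) :
    IsPathOff I (γ ∘ L.symm) (L a) (L b) (L '' S) (fun x v => N x v = 1) := by
  intro c' d' hc hcd hd hdis
  obtain ⟨c, rfl⟩ := L.surjective c'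
  obtain ⟨d, rfl⟩ := L.surjective d'
  rw [L.le_iff_le] at hc hd
  rw [L.lt_iff_lt] at hcd
  rw [← L.image_Ioo, disjoint_image_iff L.injective] at hdis
  obtain ⟨hγcd, h₀⟩ := hγ c d hc hcd hd hdis
  have hmaps : MapsTo L.symm (Icc (L c) (L d)) (Icc c d) := (L.symm.preimage_Icc c d).ge
  have hL_symm := contDiffOn_orderIso_symm hcd (hL c d hc hcd hd hdis)
    (hN.continuousOn_speed hcd hγcd h₀) fun t ht => (hN.pos _ _ (h₀ t ht)).ne'
  refine ⟨hγcd.comp hL_symm.contMDiffOn hmaps, fun τ hτ => ?_⟩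
  rw [hL.velocity_comp_symm hN hγ hc hcd hd hdis hτ]
  exact hN.inv_smul (h₀ _ (hmaps hτ))

end IsArcLength

section InitialVelocity

theorem hasDerivAt_line {F : Type*} [NormedAddCommGroup F] [NormedSpace ℝ F] (p w : F) (t : ℝ) :
    HasDerivAt (fun t : ℝ => p + t • w) w t := by
  simpa using ((hasDerivAt_id t).smul_const w).const_add p

theorem mk_mfderivWithin_extChartAt_symm (x : M) {z : E} (hz : z = extChartAt I x x) (w : E) :
    (⟨(extChartAt I x).symm z,
      mfderivWithin 𝓘(ℝ, E) I (extChartAt I x).symm (range I) z w⟩ : TangentBundle I M) =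
        ⟨x, w⟩ := by
  subst hz
  refine TotalSpace.ext (extChartAt_to_inv x) (heq_of_eq ?_)
  rw [mfderivWithin_range_extChartAt_symm]
  rfl

/-- The path is a straight line in a chart. -/
theorem exists_path_of_velocity_ne_zero [I.Boundaryless] (x : M) {v : TangentSpace I x}
    (hv : v ≠ 0) :
    ∃ (γ : ℝ → M) (ε : ℝ), 0 < ε ∧ IsPathOff I γ 0 ε ∅ (fun _ v => v ≠ 0) ∧
      (⟨γ 0, velocity I γ 0 ε 0⟩ : TangentBundle I M) = ⟨x, v⟩ := by
  let w : E := v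
  let l : ℝ → E := fun t => extChartAt I x x + t • w
  have hl₀ : l 0 = extChartAt I x x := by simp [l]
  have hl : ContDiff ℝ 1 l := contDiff_const.add (contDiff_id.smul contDiff_const)
  have hnhds : l ⁻¹' (extChartAt I x).target ∈ 𝓝 (0 : ℝ) :=
    hl.continuous.continuousAt.preimage_mem_nhds (hl₀ ▸ extChartAt_target_mem_nhds x)
  obtain ⟨ε, hε, hball⟩ := Metric.nhds_basis_closedBall.mem_iff.mp hnhds
  have htarget : MapsTo l (Icc 0 ε) (extChartAt I x).target := fun t ht => hball <| by
    simpa [abs_of_nonneg ht.1] using ht.2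
  have hvel {c d t : ℝ} (hc : 0 ≤ c) (hcd : c < d) (hd : d ≤ ε) (ht : t ∈ Icc c d) :
      velocity I ((extChartAt I x).symm ∘ l) c d t =
        mfderivWithin 𝓘(ℝ, E) I (extChartAt I x).symm (range I) (l t) w :=
    velocity_comp hcd ht
      (mdifferentiableWithinAt_extChartAt_symm (htarget (Icc_subset_Icc hc hd ht)))
      (hasDerivAt_line _ w t).hasDerivWithinAt (by simp [I.range_eq_univ])
  refine ⟨(extChartAt I x).symm ∘ l, ε, hε, fun c d hc hcd hd _ => ⟨?_, fun t ht => ?_⟩, ?_⟩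
  · exact (contMDiffOn_extChartAt_symm x).comp hl.contMDiff.contMDiffOn
      (htarget.mono_left (Icc_subset_Icc hc hd))
  · obtain ⟨A, hA⟩ := isInvertible_mfderivWithin_extChartAt_symm
      (htarget (Icc_subset_Icc hc hd ht))
    rw [hvel hc hcd hd ht, ← hA]
    exact A.map_ne_zero_iff.mpr hv
  · rw [hvel le_rfl hε le_rfl (left_mem_Icc.mpr hε.le)]
    exact mk_mfderivWithin_extChartAt_symm x hl₀ w

theorem IsContinuousFinsler.exists_path_of_velocity [I.Boundaryless]
    (hN : IsContinuousFinsler I N) (x : M) {v : TangentSpace I x} (hv : N x v = 1) :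
    ∃ (γ : ℝ → M) (T : ℝ), 0 < T ∧ IsPathOff I γ 0 T ∅ (fun x v => N x v = 1) ∧
      (⟨γ 0, velocity I γ 0 T 0⟩ : TangentBundle I M) = ⟨x, v⟩ := by
  obtain ⟨γ, ε, hε, hγ, hγ₀⟩ := exists_path_of_velocity_ne_zero x (hN.ne_zero hv)
  obtain ⟨L, hL₀, -, hL⟩ := hN.exists_isArcLength hε.le finite_empty hγ
  have hT : 0 < L ε := hL₀ ▸ L.strictMono hε
  have hsymm₀ : L.symm 0 = 0 := (L.symm_apply_eq).mpr hL₀.symm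
  have hunit := hL.isPathOff_comp_symm hN hγ
  have hvel := hL.velocity_comp_symm hN hγ le_rfl hε le_rfl (disjoint_empty _) (τ := 0)
  rw [hL₀] at hvel hunit
  rw [image_empty] at hunit
  refine ⟨γ ∘ L.symm, L ε, hT, hunit, ?_⟩
  rw [hvel (left_mem_Icc.mpr hT.le), Function.comp_apply, hsymm₀]
  cases hγ₀
  rw [hv, inv_one, one_smul]

end InitialVelocity

end ArcLength

section Navigation

variable {n : ℕ} {M : Type*} [TopologicalSpace M] [ChartedSpace (Model n) M]

theorem IsPathWith.imp {γ : ℝ → M} {a b : ℝ} {P Q : ∀ x : M, Tan n x → Prop} :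
    IsPathWith γ a b P → (∀ x v, P x v → Q x v) → IsPathWith γ a b Q := by
  rintro ⟨hab, hcont, S, hS, hγ⟩ hPQ
  exact ⟨hab, hcont, S, hS, IsPathOff.imp hγ hPQ⟩

theorem IsPathOff.isPathWith {γ : ℝ → M} {a b : ℝ} {P : ∀ x : M, Tan n x → Prop}
    (hγ : IsPathOff (𝓡 n) γ a b ∅ P) (hab : a < b) : IsPathWith γ a b P :=
  ⟨hab, (hγ a b le_rfl hab le_rfl (disjoint_empty _)).1.continuousOn, ∅, finite_empty, hγ⟩

theorem IsPathWith.integral_eq_sub {N : ∀ x : M, Tan n x → ℝ} {γ : ℝ → M} {a b : ℝ} :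
    IsPathWith γ a b (fun x v => N x v = 1) →
      ∫ t in a..b, N (γ t) (mfderiv 𝓘(ℝ, ℝ) (𝓡 n) γ t (1 : ℝ)) = b - a := by
  rintro ⟨hab, -, S, hS, hγ⟩
  exact IsPathOff.integral_eq_sub hγ hab.le hS

variable [IsManifold (𝓡 n) ∞ M]

theorem IsContinuousFinsler.exists_unitSpeed {N : ∀ x : M, Tan n x → ℝ}
    (hN : IsContinuousFinsler (𝓡 n) N) {γ : ℝ → M} {a b : ℝ}
    (hγ : IsRegularPath (n := n) γ a b) :
    ∃ (σ : ℝ → M) (T : ℝ), IsPathWith (n := n) σ 0 T (fun x v => N x v = 1) ∧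
      σ 0 = γ a ∧ σ T = γ b ∧
      T = ∫ t in a..b, N (γ t) (mfderiv 𝓘(ℝ, ℝ) (𝓡 n) γ t (1 : ℝ)) := by
  obtain ⟨hab, hcont, S, hS, hreg⟩ := hγ
  obtain ⟨L, hL₀, hLb, hL⟩ := hN.exists_isArcLength hab.le hS hreg
  refine ⟨γ ∘ L.symm, L b, hL₀ ▸ ⟨L.strictMono hab, ?_, L '' S, hS.image L,
    hL.isPathOff_comp_symm hN hreg⟩, ?_, by simp, hLb⟩
  · exact hcont.comp L.symm.continuous.continuousOn (L.symm.preimage_Icc a b).ge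
  · rw [← hL₀, Function.comp_apply, L.symm_apply_apply]

theorem NavigationData.isContinuousFinsler (D : NavigationData n M) :
    IsContinuousFinsler (𝓡 n) D.randersNorm :=
  ⟨D.continuous_randersNorm.continuousOn, fun x _ => D.randersNorm_pos x,
    fun x _ v hc => D.randersNorm_smul x hc.le v⟩

namespace FinslerMetric

variable {F : FinslerMetric n M} {D : NavigationData n M}

theorem isContinuousFinsler (F : FinslerMetric n M) : IsContinuousFinsler (𝓡 n) F.toFun :=
  ⟨F.contMDiffOn.continuousOn, F.pos, fun x c v hc => F.homogeneous x c hc v⟩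

theorem IsUnitSpeed.length_eq {γ : ℝ → M} {T : ℝ} (hγ : F.IsUnitSpeed γ 0 T) :
    F.length γ 0 T = T :=
  (IsPathWith.integral_eq_sub hγ).trans (sub_zero T)

theorem IsUnitSpeed.isRegularPath {γ : ℝ → M} {a b : ℝ} (hγ : F.IsUnitSpeed γ a b) :
    IsRegularPath (n := n) γ a b :=
  hγ.imp fun _ _ => F.isContinuousFinsler.ne_zero

theorem solves_of_eq_one_iff (h : ∀ x v, F.toFun x v = 1 ↔ D.IsVelocity x v) : F.Solves D := by
  have htraj (γ : ℝ → M) (T : ℝ) : D.IsTrajectory γ T ↔ F.IsUnitSpeed γ 0 T :=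
    ⟨fun hγ => hγ.imp fun x v => (h x v).mpr, fun hγ => hγ.imp fun x v => (h x v).mp⟩
  refine ⟨fun γ T hγ => ((htraj γ T).mp hγ).length_eq, fun γ T => ?_⟩
  simp only [NavigationData.IsTimeOptimal, htraj]
  refine and_congr_right fun hγ => ⟨fun hopt => ⟨hγ.isRegularPath, fun σ c d hσ hc hd => ?_⟩,
    fun ⟨_, hshort⟩ σ T' hσ h₀ hσT => ?_⟩
  · obtain ⟨ρ, T', hρ, hρ₀, hρT', hlength⟩ := F.isContinuousFinsler.exists_unitSpeed hσ
    rw [hγ.length_eq]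
    exact (hopt ρ T' hρ (hρ₀.trans hc) (hρT'.trans hd)).trans_eq hlength
  · rw [← hγ.length_eq, ← hσ.length_eq]
    exact hshort σ 0 T' hσ.isRegularPath h₀ hσT

/-- Along a unit-speed path of the Randers norm with initial velocity `v`, the transit times of all
initial pieces determine the `F`-speed at the start. -/
theorem Solves.eq_one_of_randersNorm_eq_one (h : F.Solves D) (x : M) (v : Tan n x)
    (hv : D.randersNorm x v = 1) : F.toFun x v = 1 := by
  obtain ⟨γ, T, hT, hγ, hγ₀⟩ := D.isContinuousFinsler.exists_path_of_velocity x hv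
  obtain ⟨hsmooth, hunit⟩ := hγ 0 T le_rfl hT le_rfl (disjoint_empty _)
  have htraj {τ : ℝ} (hτ : τ ∈ Ioc 0 T) : D.IsTrajectory γ τ :=
    ((hγ.mono le_rfl hτ.2).imp fun x v => (D.randersNorm_eq_one_iff x v).mp).isPathWith hτ.1
  have hcont := F.isContinuousFinsler.continuousOn_speed hT hsmooth
    fun t ht => D.isContinuousFinsler.ne_zero (hunit t ht)
  cases hγ₀
  refine eq_of_forall_integral_eq_smul hT hcont fun τ hτ => ?_
  calc ∫ t in (0 : ℝ)..τ, F.toFun (γ t) (velocity (𝓡 n) γ 0 T t)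
      = F.length γ 0 τ := intervalIntegral.integral_congr_Ioo_of_le (μ := volume) hτ.1.le
        fun t ht => congrArg (F.toFun (γ t)) (velocity_eq_mfderiv γ ⟨ht.1, ht.2.trans_le hτ.2⟩)
    _ = τ := h.transit_time γ τ (htraj hτ)
    _ = (τ - 0) • (1 : ℝ) := by rw [smul_eq_mul, sub_zero, mul_one]

theorem solves_iff_eq_randersNorm : F.Solves D ↔ ∀ x v, F.toFun x v = D.randersNorm x v := by
  refine ⟨fun h => ?_, fun h => solves_of_eq_one_iff fun x v => ?_⟩
  · exact D.isContinuousFinsler.eq_of_forall_eq_one F.isContinuousFinsler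
      h.eq_one_of_randersNorm_eq_one
  · rw [h, D.randersNorm_eq_one_iff]

theorem IsRanders.exists_solves (hF : F.IsRanders) {s : M → ℝ}
    (hs : ContMDiff (𝓡 n) 𝓘(ℝ, ℝ) ∞ s) (hs' : ∀ x, 0 < s x ∧ s x ≤ 1) :
    ∃ D : NavigationData n M, D.speed = s ∧ F.Solves D := by
  obtain ⟨a, β, hβ, hFaβ⟩ := hF
  obtain ⟨D, hDs, hD⟩ := exists_navigationData_of_randers a hβ
    (fun x v hv => hFaβ x v ▸ F.pos x v hv) hs (fun x => (hs' x).1) fun x => (hs' x).2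
  exact ⟨D, hDs, solves_iff_eq_randersNorm.mpr fun x v => (hFaβ x v).trans (hD x v).symm⟩

end FinslerMetric

end Navigation

end ZermeloNavigation

open ZermeloNavigation in
theorem mainTheorem1_general {n : ℕ} [NeZero n] {M : Type*} [TopologicalSpace M]
    [ChartedSpace (EuclideanSpace ℝ (Fin n)) M] [IsManifold (𝓡 n) ∞ M]
    (F : FinslerMetric n M) :
    (F.IsRanders ↔ ∃ D : NavigationData n M, F.Solves D) ∧
    (F.IsRanders → ∀ s : M → ℝ, ContMDiff (𝓡 n) 𝓘(ℝ, ℝ) ∞ s → (∀ x, 0 < s x ∧ s x ≤ 1) →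
      ∃ D : NavigationData n M, D.speed = s ∧ F.Solves D) ∧
    (∀ D : NavigationData n M, F.Solves D →
      (F.IsRiemannian ↔ ∀ x, D.W x = 0) ∧
      (F.IsConformalTo D.h ↔ ∀ x, D.W x = 0) ∧
      (F.IsScalingOf D.h ↔ (∀ x, D.W x = 0) ∧ ∃ k : ℝ, ∀ x, D.speed x ^ 2 = k)) := by
  refine ⟨⟨fun hF => ?_, fun ⟨D, hD⟩ => ?_⟩, fun hF s hs hs' => hF.exists_solves hs hs',
    fun D hD => ?_⟩
  · obtain ⟨D, -, hD⟩ := hF.exists_solves contMDiff_const fun _ => ⟨one_pos, le_rfl⟩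
    exact ⟨D, hD⟩
  · exact FinslerMetric.isRanders_of_eq_randersNorm (FinslerMetric.solves_iff_eq_randersNorm.mp hD)
  · have hFD := FinslerMetric.solves_iff_eq_randersNorm.mp hD
    exact ⟨FinslerMetric.isRiemannian_iff_wind_eq_zero hFD,
      FinslerMetric.isConformalTo_iff_wind_eq_zero hFD,
      FinslerMetric.isScalingOf_iff_wind_eq_zero_and_speed hFD⟩

theorem mainTheorem1 {n : ℕ} [NeZero n] {M : Type*} [TopologicalSpace M]
    [ChartedSpace (EuclideanSpace ℝ (Fin n)) M] [IsManifold (𝓡 n) ∞ M]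
    [T2Space M] [SecondCountableTopology M]
    (F : ZermeloNavigation.FinslerMetric n M) (hF : F.IsStronglyConvex) :
    -- `F` is of Randers type iff it solves a generalized navigation problem
    (F.IsRanders ↔ ∃ D : ZermeloNavigation.NavigationData n M, F.Solves D) ∧
    -- if `F` is of Randers type, the own speed in such a problem may be prescribed
    (F.IsRanders → ∀ s : M → ℝ, ContMDiff (𝓡 n) 𝓘(ℝ, ℝ) ∞ s → (∀ x, 0 < s x ∧ s x ≤ 1) →
      ∃ D : ZermeloNavigation.NavigationData n M, D.speed = s ∧ F.Solves D) ∧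
    -- characterizations of the Riemannian cases, for every problem that `F` solves
    (∀ D : ZermeloNavigation.NavigationData n M, F.Solves D →
      (F.IsRiemannian ↔ ∀ x, D.W x = 0) ∧
      (F.IsConformalTo D.h ↔ ∀ x, D.W x = 0) ∧
      (F.IsScalingOf D.h ↔ (∀ x, D.W x = 0) ∧ ∃ k : ℝ, ∀ x, D.speed x ^ 2 = k)) :=
  mainTheorem1_general F
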